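/- For a nonempty compact convex set $K\subset\mathbb{R}^2\cong\mathbb{C}$, let $h_K(\theta)=\max\{x\cdot e^{i\theta} : x\in K\}$ be its support function, $s(K)=\frac1\pi\int_0^{2\pi}h_K(\theta)e^{i\theta}\,d\theta$ its Steiner point, and $P(K)$ its perimeter (the length of its boundary curve, i.e. the least upper bound of the perimeters of the convex polygons inscribed in $K$; for a line segment this is twice its length). If $s(K)=0$, then $$\max_\theta h_K(\theta)\;\le\;\frac{P(K)}{4}\;\le\;\min_\theta h_K(\theta)+\max_\theta h_K(\theta).$$ Both inequalities are sharp: each is an equality for every line segment whose Steiner point is the origin, and for every $L>0$ there is such a segment with perimeter $L$. -/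

import Mathlib

/-- The support function `h_K(θ) = max {x · e^{iθ} : x ∈ K}` of a set `K` in the plane `ℝ² = ℂ`.
For nonempty compact `K`, the supremum is a maximum. -/
noncomputable def supportFun (K : Set ℂ) (θ : ℝ) : ℝ :=
  sSup ((fun x : ℂ => (x * (starRingEnd ℂ) (Complex.exp (θ * Complex.I))).re) '' K)

/-- The Steiner point `s(K) = (1/π) ∫₀^{2π} h_K(θ) e^{iθ} dθ`. -/
noncomputable def steinerPoint (K : Set ℂ) : ℂ :=
  (1 / (Real.pi : ℂ)) *
    ∫ θ in (0 : ℝ)..(2 * Real.pi), (supportFun K θ : ℂ) * Complex.exp (θ * Complex.I)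

/-- The cyclically indexed points `x 0, …, x n` are the vertices, in counterclockwise order, of a
convex polygon traversed once: the directions `φ i` of the successive edges `x (i + 1) - x i`
turn monotonically, through at most one full turn. (Addition in `Fin (n + 1)` is cyclic.)
Degenerate polygons are allowed: a single point, or a segment traversed there and back. -/
def IsConvexPolygon {n : ℕ} (x : Fin (n + 1) → ℂ) : Prop :=
  ∃ φ : Fin (n + 1) → ℝ, Monotone φ ∧ φ (Fin.last n) ≤ φ 0 + 2 * Real.pi ∧
    ∀ i, x (i + 1) - x i = (‖x (i + 1) - x i‖ : ℂ) * Complex.exp (φ i * Complex.I)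

/-- The perimeter of a closed polygon. -/
noncomputable def polygonPerimeter {n : ℕ} (x : Fin (n + 1) → ℂ) : ℝ :=
  ∑ i, ‖x (i + 1) - x i‖

/-- The perimeter of a compact convex set in the plane: the length of its boundary curve, that is,
the least upper bound of the perimeters of the convex polygons inscribed in it. The perimeter of
a line segment is twice its length. -/
noncomputable def perimeter (K : Set ℂ) : ℝ :=
  sSup {ℓ : ℝ | ∃ (n : ℕ) (x : Fin (n + 1) → ℂ),
    IsConvexPolygon x ∧ (∀ i, x i ∈ K) ∧ ℓ = polygonPerimeter x}

/-!
Let `h` be the support function of `K` and `P` its perimeter.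

Cauchy's formula `P = ∫ h` (`perimeter_eq_integral`) holds because the support function dominates,
between two consecutive edge normals of an inscribed convex polygon, the linear function of the
common vertex, which gives `≤` (`polygonPerimeter_le_integral`), while the polygon through the
support points in `N` equally spaced directions has perimeter at least a Riemann sum of `h`, which
gives `≥` (`riemannSum_le_perimeter`).

For smooth `h`, the density `h'' + h` is the radius of curvature, hence nonnegative. When the
Steiner point is the origin, `h` has no first harmonic, and `2π h(α) = ∫ G(t) (h'' + h)(α + t) dt`
for the Green kernel `G(t) = (π - t) sin t`, `0 ≤ t ≤ 2π` (`greenKernel`). Since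
`∫ (h'' + h) = P` and `h'' + h` is orthogonal to `cos` and `sin`, both inequalities reduce to
pointwise bounds on the kernel:
* `G(t) - cos t ≤ π / 2` (`greenKernel_sub_cos_le`) gives `h(α) ≤ P / 4` for all `α`;
* `G(t) + (G(t + π/2) + G(t - π/2)) / 2 ≥ π / 2` (`pi_div_two_le_greenKernel_add`) gives
  `P / 4 ≤ h(α) + (h(α + π/2) + h(α - π/2)) / 2` for all `α`, in particular at a minimum of `h`.

Since `h` need not be differentiable, `h'' + h` is replaced by the second differences
`h(t + ε) + h(t - ε) - 2 cos ε · h(t)`, which are nonnegative because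
`e^{i(t + ε)} + e^{i(t - ε)} = 2 cos ε · e^{it}`, sampled at the multiples of `ε = 2π / N`. The
Green representation then holds up to a Riemann sum (`sum_greenKernel_mul`), and `N → ∞`.

For a segment the Steiner point is the midpoint. If it is the origin, then `min h = 0` and `max h`
is half the length, so the two inequalities determine `P`.
-/

open Real Filter Topology

/-! ### Riemann sums over the full period -/

theorem tendsto_riemannSum {f : ℝ → ℝ} (hf : Continuous f) :
    Tendsto (fun N : ℕ => 2 * π / N * ∑ j ∈ Finset.range N, f (j * (2 * π / N))) atTop
      (𝓝 (∫ t in (0 : ℝ)..(2 * π), f t)) := by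
  have huc : UniformContinuousOn f (Set.Icc 0 (2 * π)) :=
    isCompact_Icc.uniformContinuousOn_of_continuous hf.continuousOn
  rw [Metric.uniformContinuousOn_iff] at huc
  rw [Metric.tendsto_atTop]
  intro δ hδ
  have hpi := pi_pos
  obtain ⟨η, hη, hfη⟩ := huc (δ / (4 * π)) (by positivity)
  obtain ⟨N₀, hN₀⟩ := exists_nat_gt (2 * π / η)
  refine ⟨N₀ + 1, fun N hN => ?_⟩
  have hNpos : (0 : ℝ) < N := by
    have : 0 < N := by omega
    exact_mod_cast this
  set ε : ℝ := 2 * π / N with hε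
  have hε0 : 0 < ε := by positivity
  have hNε : N * ε = 2 * π := by rw [hε]; field_simp
  have hεη : ε < η := by
    rw [hε, div_lt_iff₀ hNpos]
    rw [div_lt_iff₀ hη] at hN₀
    have : (N₀ : ℝ) ≤ N := by exact_mod_cast (by omega : N₀ ≤ N)
    nlinarith
  have hsplit : ∫ t in (0 : ℝ)..(2 * π), f t
      = ∑ j ∈ Finset.range N, ∫ t in (j * ε)..((j + 1 : ℕ) * ε), f t := by
    rw [intervalIntegral.sum_integral_adjacent_intervals (a := fun j : ℕ => (j : ℝ) * ε)
      (fun k _ => hf.intervalIntegrable _ _)]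
    simp [hNε]
  have hterm : ∀ j ∈ Finset.range N,
      ‖ε * f (j * ε) - ∫ t in (j * ε)..((j + 1 : ℕ) * ε), f t‖ ≤ δ / (4 * π) * ε := by
    intro j hj
    have hj' : ((j + 1 : ℕ) : ℝ) ≤ N := by
      exact_mod_cast Finset.mem_range.1 hj
    have hle : (j : ℝ) * ε ≤ (j + 1 : ℕ) * ε := by push_cast; nlinarith
    have hub : ((j + 1 : ℕ) : ℝ) * ε ≤ 2 * π := by rw [← hNε]; gcongr
    have hc : ε * f (j * ε) = ∫ t in ((j : ℝ) * ε)..((j + 1 : ℕ) * ε), f (j * ε) := by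
      rw [intervalIntegral.integral_const, smul_eq_mul]; push_cast; ring
    rw [hc, ← intervalIntegral.integral_sub (by simp) (hf.intervalIntegrable _ _)]
    have h1 := intervalIntegral.norm_integral_le_of_norm_le_const
      (a := (j : ℝ) * ε) (b := (j + 1 : ℕ) * ε) (C := δ / (4 * π))
      (f := fun t => f (j * ε) - f t) (fun t ht => by
        rw [Set.uIoc_of_le hle] at ht
        have h0 : (0 : ℝ) ≤ j * ε := by positivity
        have := hfη (j * ε) ⟨h0, by linarith [ht.1, ht.2]⟩ t
          ⟨by linarith [ht.1], by linarith [ht.2]⟩ (by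
            have h2 := ht.2
            push_cast at h2
            rw [Real.dist_eq, abs_lt]; constructor <;> nlinarith [ht.1])
        rw [Real.dist_eq] at this
        exact this.le)
    refine h1.trans (le_of_eq ?_)
    push_cast
    rw [show ((j : ℝ) + 1) * ε - j * ε = ε by ring, abs_of_pos hε0]
  rw [Real.dist_eq, hsplit, Finset.mul_sum, ← Finset.sum_sub_distrib]
  calc _ ≤ ∑ j ∈ Finset.range N, δ / (4 * π) * ε :=
        (Finset.abs_sum_le_sum_abs _ _).trans (Finset.sum_le_sum hterm)
    _ = δ / (4 * π) * (N * ε) := by simp; ring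
    _ = δ / 2 := by rw [hNε]; field_simp; norm_num
    _ < δ := by linarith

theorem tendsto_two_pi_div_nat : Tendsto (fun N : ℕ => 2 * π / (N : ℝ)) atTop (𝓝 0) :=
  tendsto_const_div_atTop_nhds_zero_nat _

theorem tendsto_sinc_comp {u : ℕ → ℝ} (hu : Tendsto u atTop (𝓝 0)) :
    Tendsto (fun N => sinc (u N)) atTop (𝓝 1) := by
  simpa [Function.comp_def] using (continuous_sinc.tendsto 0).comp hu

/-- Riemann sums of a periodic function do not change when the sample points move by one step. -/
theorem sum_add_step {f : ℝ → ℝ} (hf : Function.Periodic f (2 * π)) {N : ℕ} {ε : ℝ}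
    (hε : N * ε = 2 * π) :
    ∑ j ∈ Finset.range N, f (j * ε + ε) = ∑ j ∈ Finset.range N, f (j * ε) := by
  have h1 := Finset.sum_range_succ (fun j : ℕ => f (j * ε)) N
  have h2 := Finset.sum_range_succ' (fun j : ℕ => f (j * ε)) N
  have h3 : f (N * ε) = f ((0 : ℕ) * ε) := by
    rw [hε]; simpa using hf 0
  have h4 : ∀ j : ℕ, f (j * ε + ε) = f ((j + 1 : ℕ) * ε) := by
    intro j; push_cast; ring_nf
  simp_rw [h4]
  linarith

theorem sum_add_nat_step {f : ℝ → ℝ} (hf : Function.Periodic f (2 * π)) {N : ℕ} {ε : ℝ}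
    (hε : N * ε = 2 * π) (k : ℕ) :
    ∑ j ∈ Finset.range N, f (j * ε + k * ε) = ∑ j ∈ Finset.range N, f (j * ε) := by
  induction k with
  | zero => simp
  | succ k ih =>
    rw [← ih]
    have hp : Function.Periodic (fun t => f (t + k * ε)) (2 * π) := fun t => by
      change f (t + 2 * π + k * ε) = f (t + k * ε)
      rw [← hf (t + k * ε)]; ring_nf
    rw [← sum_add_step hp hε]
    refine Finset.sum_congr rfl fun j _ => ?_
    push_cast; ring_nf

/-- Discrete integration by parts over a period: the operator `f ↦ f (· + ε) + f (· - ε)` is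
symmetric. -/
theorem sum_mul_shift_comm {f g : ℝ → ℝ} (hf : Function.Periodic f (2 * π))
    (hg : Function.Periodic g (2 * π)) {N : ℕ} {ε : ℝ} (hε : N * ε = 2 * π) :
    ∑ j ∈ Finset.range N, f (j * ε) * (g (j * ε + ε) + g (j * ε - ε))
      = ∑ j ∈ Finset.range N, g (j * ε) * (f (j * ε + ε) + f (j * ε - ε)) := by
  have key : ∀ {f g : ℝ → ℝ}, Function.Periodic f (2 * π) → Function.Periodic g (2 * π) →
      ∑ j ∈ Finset.range N, f (j * ε) * g (j * ε + ε)
        = ∑ j ∈ Finset.range N, g (j * ε) * f (j * ε - ε) := by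
    intro f g hf hg
    have hp : Function.Periodic (fun t => g t * f (t - ε)) (2 * π) := fun t => by
      change g (t + 2 * π) * f (t + 2 * π - ε) = g t * f (t - ε)
      rw [hg, ← hf (t - ε)]; ring_nf
    rw [← sum_add_step hp hε]
    refine Finset.sum_congr rfl fun j _ => ?_
    rw [add_sub_cancel_right, mul_comm]
  simp_rw [mul_add, Finset.sum_add_distrib]
  rw [key hf hg, ← key hg hf]
  ring

/-! ### The Green kernel of `h'' + h` on the circle -/

/-- The kernel `(π - t) sin t` for `0 ≤ t ≤ 2π`, continued with period `2π`. Up to the factor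
`1 / (2π)`, it is the Green function of `h ↦ h'' + h` on periodic functions without first
harmonics. The factor `arccos (-cos t)` is `|π - t|` there, which makes periodicity and evenness
evident. -/
noncomputable def greenKernel (t : ℝ) : ℝ := arccos (-cos t) * |sin t|

theorem greenKernel_periodic : Function.Periodic greenKernel (2 * π) := fun t => by
  simp [greenKernel]

theorem greenKernel_neg (t : ℝ) : greenKernel (-t) = greenKernel t := by
  simp [greenKernel]

theorem greenKernel_of_mem {t : ℝ} (h0 : 0 ≤ t) (h1 : t ≤ 2 * π) :
    greenKernel t = (π - t) * sin t := by
  unfold greenKernel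
  rcases le_total t π with h | h
  · rw [arccos_neg, arccos_cos h0 h, abs_of_nonneg (sin_nonneg_of_nonneg_of_le_pi h0 h)]
  · rw [← cos_sub_pi, arccos_cos (by linarith) (by linarith)]
    have : 0 ≤ sin (t - π) := sin_nonneg_of_nonneg_of_le_pi (by linarith) (by linarith)
    rw [sin_sub_pi] at this
    rw [abs_of_nonpos (by linarith)]
    ring

/-- Away from the kink at `0`, the second difference of the kernel is proportional to `cos`. -/
theorem greenKernel_second_diff {t ε : ℝ} (hε : 0 ≤ ε) (h0 : ε ≤ t) (h1 : t + ε ≤ 2 * π) :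
    greenKernel (t + ε) + greenKernel (t - ε) - 2 * cos ε * greenKernel t
      = -(2 * ε * sin ε * cos t) := by
  rw [greenKernel_of_mem (by linarith) h1, greenKernel_of_mem (by linarith) (by linarith),
    greenKernel_of_mem (by linarith) (by linarith), sin_add, sin_sub]
  ring

theorem greenKernel_second_diff_zero {ε : ℝ} (hε : 0 ≤ ε) (h1 : ε ≤ 2 * π) :
    greenKernel (0 + ε) + greenKernel (0 - ε) - 2 * cos ε * greenKernel 0
      = 2 * π * sin ε - 2 * ε * sin ε * cos 0 := by
  rw [zero_add, zero_sub, greenKernel_neg, greenKernel_of_mem hε h1]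
  simp [greenKernel]
  ring

theorem cos_eq_one_sub_two_mul_sin_half_sq (s : ℝ) : cos s = 1 - 2 * sin (s / 2) ^ 2 := by
  rw [sin_sq, show s = 2 * (s / 2) by ring, cos_two_mul]
  ring_nf

theorem mul_sin_add_cos_le {s : ℝ} (h0 : 0 ≤ s) (h1 : s ≤ π) : s * sin s + cos s ≤ π / 2 := by
  have hs := sin_le_one s
  have hs0 := sin_nonneg_of_nonneg_of_le_pi h0 h1
  rcases le_total s (π / 2) with h | h
  · have := sin_le (x := π / 2 - s) (by linarith)
    rw [sin_pi_div_two_sub] at this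
    nlinarith
  · -- with `v = s - π / 2` this is `(π / 2 + v) cos v - sin v ≤ π / 2`, where `v cos v ≤ sin v`
    have hv0 : 0 ≤ s - π / 2 := by linarith
    have hv : (s - π / 2) * cos (s - π / 2) ≤ sin (s - π / 2) := by
      rcases eq_or_lt_of_le h1 with h' | h'
      · rw [h', show π - π / 2 = π / 2 by ring]; simp
      · have hc : 0 < cos (s - π / 2) :=
          cos_pos_of_mem_Ioo ⟨by linarith, by linarith⟩
        have := le_tan hv0 (by linarith)
        rwa [tan_eq_sin_div_cos, le_div_iff₀ hc] at this
    rw [cos_sub_pi_div_two, sin_sub_pi_div_two] at hv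
    nlinarith

/-- The function `4 u cos u - π sin u` is concave on `[0, π / 4]` and vanishes at both ends. -/
theorem pi_mul_sin_le_four_mul_cos {u : ℝ} (h0 : 0 ≤ u) (h1 : u ≤ π / 4) :
    π * sin u ≤ 4 * (u * cos u) := by
  have hpi := pi_pos
  have hd : ∀ x : ℝ, HasDerivAt (fun u => 4 * (u * cos u) - π * sin u)
      ((4 - π) * cos x - 4 * (x * sin x)) x := fun x => by
    have := (((hasDerivAt_id' x).mul (hasDerivAt_cos x)).const_mul 4).sub
      ((hasDerivAt_sin x).const_mul π)
    exact this.congr_deriv (by ring)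
  have hconc : ConcaveOn ℝ (Set.Icc 0 (π / 4)) (fun u => 4 * (u * cos u) - π * sin u) := by
    refine AntitoneOn.concaveOn_of_deriv (convex_Icc _ _) (by fun_prop) (by fun_prop) ?_
    rw [interior_Icc]
    intro x hx y hy hxy
    rw [(hd x).deriv, (hd y).deriv]
    have hc : cos y ≤ cos x := cos_le_cos_of_nonneg_of_le_pi hx.1.le (by linarith [hy.2]) hxy
    have hs : sin x ≤ sin y := sin_le_sin_of_le_of_le_pi_div_two (by linarith [hx.1])
      (by linarith [hy.2]) hxy
    have hs0 : 0 ≤ sin x := sin_nonneg_of_nonneg_of_le_pi hx.1.le (by linarith [hx.2])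
    have hm : x * sin x ≤ y * sin y := mul_le_mul hxy hs hs0 (by linarith [hy.1])
    nlinarith [pi_le_four]
  have h := hconc.2 (Set.left_mem_Icc.2 (by positivity)) (Set.right_mem_Icc.2 (by positivity))
    (sub_nonneg.2 ((div_le_one (by positivity)).2 h1)) (show 0 ≤ u / (π / 4) by positivity)
    (by ring)
  have hu : u / (π / 4) * (π / 4) = u := by field_simp
  have h4 : 4 * (π / 4 * (√2 / 2)) - π * (√2 / 2) = 0 := by ring
  simp only [smul_eq_mul, mul_zero, zero_add, hu, cos_pi_div_four, sin_pi_div_four, h4, sin_zero,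
    zero_mul, sub_zero] at h
  linarith

theorem pi_div_two_le_mul_sin_add_cos {s : ℝ} (h0 : 0 ≤ s) (h1 : s ≤ π / 2) :
    π / 2 ≤ s * sin s + π / 2 * cos s := by
  have h := pi_mul_sin_le_four_mul_cos (u := s / 2) (by linarith) (by linarith)
  have hs := sin_nonneg_of_nonneg_of_le_pi (x := s / 2) (by linarith) (by linarith)
  have e1 : sin s = 2 * sin (s / 2) * cos (s / 2) := by rw [← sin_two_mul]; ring_nf
  rw [e1, cos_eq_one_sub_two_mul_sin_half_sq s]
  nlinarith [mul_le_mul_of_nonneg_left h hs]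

theorem pi_div_two_le_mul_sin_add_abs_cos {s : ℝ} (h0 : 0 ≤ s) (h1 : s ≤ π) :
    π / 2 ≤ s * sin s + π / 2 * |cos s| := by
  rcases le_total s (π / 2) with h | h
  · exact (pi_div_two_le_mul_sin_add_cos h0 h).trans (by gcongr; exact le_abs_self _)
  · have hs0 := sin_nonneg_of_nonneg_of_le_pi h0 h1
    have h2 : 1 ≤ sin s + |cos s| := by
      nlinarith [sin_sq_add_cos_sq s, abs_nonneg (cos s), sq_abs (cos s),
        mul_nonneg hs0 (abs_nonneg (cos s))]
    nlinarith [pi_pos]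

theorem greenKernel_sub_cos_le (t : ℝ) : greenKernel t - cos t ≤ π / 2 := by
  have h := mul_sin_add_cos_le (arccos_nonneg (-cos t)) (arccos_le_pi _)
  rw [cos_arccos (by linarith [cos_le_one t]) (by linarith [neg_one_le_cos t]), sin_arccos,
    neg_sq, ← abs_sin_eq_sqrt_one_sub_cos_sq] at h
  unfold greenKernel
  linarith

theorem pi_div_two_le_greenKernel_add (t : ℝ) :
    π / 2 ≤ greenKernel t + (greenKernel (t + π / 2) + greenKernel (t - π / 2)) / 2 := by
  have h := pi_div_two_le_mul_sin_add_abs_cos (arccos_nonneg (-cos t)) (arccos_le_pi _)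
  rw [cos_arccos (by linarith [cos_le_one t]) (by linarith [neg_one_le_cos t]), sin_arccos,
    neg_sq, ← abs_sin_eq_sqrt_one_sub_cos_sq, abs_neg] at h
  have h2 : greenKernel (t + π / 2) + greenKernel (t - π / 2) = π * |cos t| := by
    simp only [greenKernel, cos_add_pi_div_two, sin_add_pi_div_two, cos_sub_pi_div_two,
      sin_sub_pi_div_two, abs_neg, neg_neg, arccos_neg]
    ring
  rw [h2]
  unfold greenKernel
  linarith

/-! ### Sharp bounds for functions with nonnegative `h'' + h` -/

/-- The discrete Green representation: testing the second differences of a periodic function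
against `greenKernel` recovers the value at `0`, up to the first harmonic. -/
theorem sum_greenKernel_mul {h : ℝ → ℝ} (hper : Function.Periodic h (2 * π)) {N : ℕ} {ε : ℝ}
    (hN : 1 ≤ N) (hε : N * ε = 2 * π) :
    ∑ j ∈ Finset.range N,
        greenKernel (j * ε) * (h (j * ε + ε) + h (j * ε - ε) - 2 * cos ε * h (j * ε))
      = 2 * π * sin ε * h 0 - 2 * ε * sin ε * ∑ j ∈ Finset.range N, h (j * ε) * cos (j * ε) := by
  have hpi := pi_pos
  have hN' : (1 : ℝ) ≤ N := by exact_mod_cast hN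
  have hε0 : 0 ≤ ε := by
    by_contra hneg
    nlinarith
  have hε1 : ε ≤ 2 * π := by nlinarith
  have hterm : ∀ j ∈ Finset.range N,
      h (j * ε) * (greenKernel (j * ε + ε) + greenKernel (j * ε - ε)
        - 2 * cos ε * greenKernel (j * ε))
      = (if j = 0 then 2 * π * sin ε * h 0 else 0)
        - 2 * ε * sin ε * (h (j * ε) * cos (j * ε)) := by
    intro j hj
    rcases Nat.eq_zero_or_pos j with rfl | hj0
    · rw [Nat.cast_zero, zero_mul, greenKernel_second_diff_zero hε0 hε1]
      simp
      ring
    · have h1 : ((j : ℝ) + 1) ≤ N := by exact_mod_cast Finset.mem_range.1 hj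
      have h2 : (1 : ℝ) ≤ j := by exact_mod_cast hj0
      rw [greenKernel_second_diff hε0 (by nlinarith) (by nlinarith), if_neg (by omega)]
      ring
  have hswap : ∑ j ∈ Finset.range N,
        greenKernel (j * ε) * (h (j * ε + ε) + h (j * ε - ε) - 2 * cos ε * h (j * ε))
      = ∑ j ∈ Finset.range N, h (j * ε) * (greenKernel (j * ε + ε) + greenKernel (j * ε - ε)
        - 2 * cos ε * greenKernel (j * ε)) := by
    simp_rw [mul_sub, Finset.sum_sub_distrib]
    rw [sum_mul_shift_comm greenKernel_periodic hper hε]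
    congr 1
    exact Finset.sum_congr rfl fun j _ => by ring
  rw [hswap, Finset.sum_congr rfl hterm, Finset.sum_sub_distrib, ← Finset.mul_sum,
    Finset.sum_ite_eq']
  simp [show 0 < N by omega]

theorem sum_second_diff {h : ℝ → ℝ} (hper : Function.Periodic h (2 * π)) {N : ℕ} {ε : ℝ}
    (hε : N * ε = 2 * π) :
    ∑ j ∈ Finset.range N, (h (j * ε + ε) + h (j * ε - ε) - 2 * cos ε * h (j * ε))
      = (2 - 2 * cos ε) * ∑ j ∈ Finset.range N, h (j * ε) := by
  have h1 := sum_mul_shift_comm (f := fun _ => 1) (fun _ => rfl) hper hε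
  simp only [one_mul] at h1
  rw [Finset.sum_sub_distrib, h1, Finset.mul_sum, ← Finset.sum_sub_distrib]
  exact Finset.sum_congr rfl fun j _ => by ring

theorem sum_cos_mul_second_diff {h : ℝ → ℝ} (hper : Function.Periodic h (2 * π)) {N : ℕ} {ε : ℝ}
    (hε : N * ε = 2 * π) :
    ∑ j ∈ Finset.range N,
      cos (j * ε) * (h (j * ε + ε) + h (j * ε - ε) - 2 * cos ε * h (j * ε)) = 0 := by
  simp_rw [mul_sub, Finset.sum_sub_distrib]
  rw [sum_mul_shift_comm cos_periodic hper hε, ← Finset.sum_sub_distrib]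
  refine Finset.sum_eq_zero fun j _ => ?_
  rw [cos_add, cos_sub]
  ring

theorem two_sub_two_mul_cos (ε : ℝ) : 2 - 2 * cos ε = ε ^ 2 * sinc (ε / 2) ^ 2 := by
  rcases eq_or_ne ε 0 with rfl | h
  · simp
  · rw [sinc_of_ne_zero (by positivity)]
    rw [cos_eq_one_sub_two_mul_sin_half_sq]
    field_simp
    ring

theorem sin_eq_mul_sinc (ε : ℝ) : sin ε = ε * sinc ε := by
  rcases eq_or_ne ε 0 with rfl | h
  · simp
  · rw [sinc_of_ne_zero h]; field_simp

/-- The limit of the Green representation tested against the nonnegative function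
`π / 2 - greenKernel + cos`. -/
theorem le_integral_of_second_diff_nonneg {h : ℝ → ℝ} (hcont : Continuous h)
    (hper : Function.Periodic h (2 * π))
    (hconv : ∀ θ ε, 2 * cos ε * h θ ≤ h (θ + ε) + h (θ - ε)) :
    2 * π * h 0 ≤ π / 2 * (∫ t in (0 : ℝ)..(2 * π), h t)
      + 2 * ∫ t in (0 : ℝ)..(2 * π), h t * cos t := by
  have hS := tendsto_sinc_comp tendsto_two_pi_div_nat
  have hS2 := tendsto_sinc_comp (u := fun N : ℕ => 2 * π / N / 2)
    (by simpa using tendsto_two_pi_div_nat.div_const 2)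
  have hA := tendsto_riemannSum hcont
  have hB := tendsto_riemannSum (f := fun t => h t * cos t) (hcont.mul continuous_cos)
  have hR := (((hS2.pow 2).const_mul (π / 2)).mul hA).add ((hS.const_mul 2).mul hB)
  have hL := (hS.const_mul (2 * π)).mul_const (h 0)
  simp only [mul_one, one_pow] at hR hL
  refine le_of_tendsto_of_tendsto hL hR ?_
  filter_upwards [eventually_ge_atTop 1] with N hN
  have hNpos : (0 : ℝ) < N := by exact_mod_cast hN
  set ε : ℝ := 2 * π / N with hεdef
  have hε0 : 0 < ε := by have := pi_pos; positivity
  have hε : N * ε = 2 * π := by rw [hεdef]; field_simp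
  have hpos : 0 ≤ ∑ j ∈ Finset.range N, (π / 2 - (greenKernel (j * ε) - cos (j * ε))) *
      (h (j * ε + ε) + h (j * ε - ε) - 2 * cos ε * h (j * ε)) :=
    Finset.sum_nonneg fun j _ => mul_nonneg (sub_nonneg.2 (greenKernel_sub_cos_le _))
      (sub_nonneg.2 (hconv _ _))
  simp_rw [sub_mul (π / 2), sub_mul (greenKernel _), Finset.sum_sub_distrib] at hpos
  rw [← Finset.mul_sum, sum_second_diff hper hε, sum_greenKernel_mul hper hN hε,
    sum_cos_mul_second_diff hper hε, two_sub_two_mul_cos, sin_eq_mul_sinc] at hpos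
  refine le_of_mul_le_mul_left ?_ hε0
  linarith

/-- The limit of the Green representations at `0` and `± π / 2`, whose kernels add up to at least
`π / 2`. -/
theorem integral_le_of_second_diff_nonneg {h : ℝ → ℝ} (hcont : Continuous h)
    (hper : Function.Periodic h (2 * π))
    (hconv : ∀ θ ε, 2 * cos ε * h θ ≤ h (θ + ε) + h (θ - ε))
    (hcos : ∀ α, ∫ t in (0 : ℝ)..(2 * π), h (t + α) * cos t = 0) :
    (∫ t in (0 : ℝ)..(2 * π), h t) ≤ 4 * (h 0 + (h (π / 2) + h (-(π / 2))) / 2) := by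
  have h4 : Tendsto (fun k : ℕ => 4 * k) atTop atTop :=
    tendsto_id.const_mul_atTop' (by norm_num)
  have hS := (tendsto_sinc_comp tendsto_two_pi_div_nat).comp h4
  have hS2 := (tendsto_sinc_comp (u := fun N : ℕ => 2 * π / N / 2)
    (by simpa using tendsto_two_pi_div_nat.div_const 2)).comp h4
  have hA := (tendsto_riemannSum hcont).comp h4
  have hB := fun α => (tendsto_riemannSum (f := fun t => h (t + α) * cos t)
    ((hcont.comp (continuous_add_const α)).mul continuous_cos)).comp h4
  have hG := fun α => ((hS.const_mul (2 * π)).mul_const (h α)).sub ((hS.const_mul 2).mul (hB α))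
  have hR := (hG 0).add (((hG (-(π / 2))).add (hG (π / 2))).div_const 2)
  have hL := ((hS2.pow 2).const_mul (π / 2)).mul hA
  simp only [Function.comp_apply, hcos] at hR
  simp only [mul_one, one_pow, mul_zero, sub_zero] at hR hL
  have hlim := le_of_tendsto_of_tendsto hL hR ?_
  · have hpi := pi_pos
    refine le_of_mul_le_mul_left ?_ (show 0 < π / 2 by positivity)
    linarith
  filter_upwards [eventually_ge_atTop 1] with k hk
  have hkpos : (0 : ℝ) < k := by exact_mod_cast hk
  simp only [Function.comp_apply]
  set N := 4 * k with hNdef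
  have hN : 1 ≤ N := by omega
  have hNpos : (0 : ℝ) < N := by exact_mod_cast hN
  set ε : ℝ := 2 * π / N with hεdef
  have hε0 : 0 < ε := by have := pi_pos; positivity
  have hε : N * ε = 2 * π := by rw [hεdef]; field_simp
  -- the number of nodes is divisible by `4`, so a quarter turn permutes them
  have hkε : k * ε = π / 2 := by
    rw [hNdef] at hε; push_cast at hε; linarith
  set S : ℝ → ℝ := fun t => h (t + ε) + h (t - ε) - 2 * cos ε * h t with hSdef
  have hshift : ∀ α, Function.Periodic (fun t => h (t + α)) (2 * π) := fun α t => by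
    change h (t + 2 * π + α) = h (t + α)
    rw [← hper (t + α)]; ring_nf
  have hSper : Function.Periodic S (2 * π) := fun t => by
    change h (t + 2 * π + ε) + h (t + 2 * π + -ε) - _ = h (t + ε) + h (t + -ε) - _
    have h1 : h (t + 2 * π + ε) = _ := hshift ε t
    have h2 : h (t + 2 * π + -ε) = _ := hshift (-ε) t
    rw [h1, h2, hper]
  have hsum : ∀ α, ∑ j ∈ Finset.range N, greenKernel (j * ε) * S (j * ε + α)
      = 2 * π * sin ε * h α
        - 2 * ε * sin ε * ∑ j ∈ Finset.range N, h (j * ε + α) * cos (j * ε) := by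
    intro α
    have := sum_greenKernel_mul (hshift α) hN hε
    rw [zero_add] at this
    rw [← this]
    refine Finset.sum_congr rfl fun j _ => ?_
    simp only [hSdef]
    ring_nf
  have hpos : 0 ≤ ∑ j ∈ Finset.range N, (greenKernel (j * ε) + (greenKernel (j * ε + π / 2)
      + greenKernel (j * ε - π / 2)) / 2 - π / 2) * S (j * ε) :=
    Finset.sum_nonneg fun j _ => mul_nonneg (sub_nonneg.2 (pi_div_two_le_greenKernel_add _))
      (sub_nonneg.2 (hconv _ _))
  have hplus : ∑ j ∈ Finset.range N, greenKernel (j * ε + π / 2) * S (j * ε)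
      = ∑ j ∈ Finset.range N, greenKernel (j * ε) * S (j * ε + -(π / 2)) := by
    have hp : Function.Periodic (fun t => greenKernel t * S (t + -(π / 2))) (2 * π) := fun t => by
      change greenKernel (t + 2 * π) * S (t + 2 * π + -(π / 2))
        = greenKernel t * S (t + -(π / 2))
      rw [greenKernel_periodic, ← hSper (t + -(π / 2))]; ring_nf
    rw [← sum_add_nat_step hp hε k, hkε]
    simp
  have hminus : ∑ j ∈ Finset.range N, greenKernel (j * ε - π / 2) * S (j * ε)
      = ∑ j ∈ Finset.range N, greenKernel (j * ε) * S (j * ε + π / 2) := by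
    have hp : Function.Periodic (fun t => greenKernel (t - π / 2) * S t) (2 * π) := fun t => by
      change greenKernel (t + 2 * π - π / 2) * S (t + 2 * π)
        = greenKernel (t - π / 2) * S t
      rw [hSper, ← greenKernel_periodic (t - π / 2)]; ring_nf
    rw [← sum_add_nat_step hp hε k, hkε]
    simp
  have hexp : ∑ j ∈ Finset.range N, (greenKernel (j * ε) + (greenKernel (j * ε + π / 2)
      + greenKernel (j * ε - π / 2)) / 2 - π / 2) * S (j * ε)
      = ∑ j ∈ Finset.range N, greenKernel (j * ε) * S (j * ε + 0)
        + (∑ j ∈ Finset.range N, greenKernel (j * ε + π / 2) * S (j * ε)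
          + ∑ j ∈ Finset.range N, greenKernel (j * ε - π / 2) * S (j * ε)) / 2
        - π / 2 * ∑ j ∈ Finset.range N, S (j * ε) := by
    rw [← Finset.sum_add_distrib, Finset.sum_div, ← Finset.sum_add_distrib, Finset.mul_sum,
      ← Finset.sum_sub_distrib]
    exact Finset.sum_congr rfl fun j _ => by rw [add_zero]; ring
  rw [hexp, hplus, hminus, hsum, hsum, hsum, sum_second_diff hper hε, two_sub_two_mul_cos,
    sin_eq_mul_sinc] at hpos
  refine le_of_mul_le_mul_left ?_ hε0
  linarith

/-! ### The support function -/

theorem re_mul_conj_exp (x : ℂ) (θ : ℝ) :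
    (x * (starRingEnd ℂ) (Complex.exp (θ * Complex.I))).re = x.re * cos θ + x.im * sin θ := by
  rw [Complex.mul_re, Complex.conj_re, Complex.conj_im, Complex.exp_ofReal_mul_I_re,
    Complex.exp_ofReal_mul_I_im]
  ring

theorem supportFun_eq (K : Set ℂ) (θ : ℝ) :
    supportFun K θ = sSup ((fun x : ℂ => x.re * cos θ + x.im * sin θ) '' K) := by
  simp only [supportFun, re_mul_conj_exp]

theorem supportFun_periodic (K : Set ℂ) : Function.Periodic (supportFun K) (2 * π) := fun θ => by
  simp [supportFun_eq]

theorem le_supportFun {K : Set ℂ} (hK : IsCompact K) {x : ℂ} (hx : x ∈ K) (θ : ℝ) :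
    x.re * cos θ + x.im * sin θ ≤ supportFun K θ := by
  rw [supportFun_eq]
  refine le_csSup (hK.image ?_).bddAbove ⟨x, hx, rfl⟩
  fun_prop

theorem exists_eq_supportFun {K : Set ℂ} (hne : K.Nonempty) (hK : IsCompact K) (θ : ℝ) :
    ∃ x ∈ K, x.re * cos θ + x.im * sin θ = supportFun K θ := by
  rw [supportFun_eq]
  exact (hK.image (f := fun x : ℂ => x.re * cos θ + x.im * sin θ) (by fun_prop)).sSup_mem
    (hne.image _)

theorem continuous_supportFun {K : Set ℂ} (hK : IsCompact K) : Continuous (supportFun K) := by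
  have : supportFun K = fun θ => sSup ((fun x : ℂ => x.re * cos θ + x.im * sin θ) '' K) :=
    funext (supportFun_eq K)
  rw [this]
  exact hK.continuous_sSup (f := fun θ (x : ℂ) => x.re * cos θ + x.im * sin θ)
    (by unfold Function.HasUncurry.uncurry; simp [Function.hasUncurryInduction]; fun_prop)

theorem supportFun_second_diff_nonneg {K : Set ℂ} (hne : K.Nonempty) (hK : IsCompact K)
    (θ ε : ℝ) :
    2 * cos ε * supportFun K θ ≤ supportFun K (θ + ε) + supportFun K (θ - ε) := by
  obtain ⟨x, hx, hxθ⟩ := exists_eq_supportFun hne hK θ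
  have h1 := le_supportFun hK hx (θ + ε)
  have h2 := le_supportFun hK hx (θ - ε)
  rw [cos_add, sin_add] at h1
  rw [cos_sub, sin_sub] at h2
  rw [← hxθ]
  linarith

/-! ### Cauchy's formula for the perimeter -/

theorem sum_fin_succ_shift {n : ℕ} {M : Type*} [AddCommMonoid M] (f : Fin (n + 1) → M) :
    ∑ i, f (i + 1) = ∑ i, f i :=
  Equiv.sum_comp (Equiv.addRight 1) f

/-- Between the directions normal to two consecutive edges, the support function dominates the
linear function of the common vertex; integrating these bounds and summing by parts leaves the
edge lengths. -/
theorem polygonPerimeter_le_integral {K : Set ℂ} (hK : IsCompact K) {n : ℕ}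
    {x : Fin (n + 1) → ℂ} (hx : IsConvexPolygon x) (hxK : ∀ i, x i ∈ K) :
    polygonPerimeter x ≤ ∫ θ in (0 : ℝ)..(2 * π), supportFun K θ := by
  obtain ⟨φ, hmono, hlast, hφ⟩ := hx
  have hcont : Continuous fun θ => supportFun K (θ - π / 2) :=
    (continuous_supportFun hK).comp (by fun_prop)
  -- the edge directions, followed by the first one after a full turn
  set ψ : ℕ → ℝ := fun k => if hk : k < n + 1 then φ ⟨k, hk⟩ else φ 0 + 2 * π with hψ
  have hψφ : ∀ i : Fin (n + 1), ψ i = φ i := fun i => by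
    simp only [hψ, i.isLt, dif_pos]
  have hψlast : ψ (n + 1) = φ 0 + 2 * π := by simp [hψ]
  have hψ0 : ψ 0 = φ 0 := by simp [hψ]
  have hψstep : ∀ i : Fin (n + 1), ψ i ≤ ψ (i + 1 : ℕ) := by
    intro i
    rw [hψφ]
    by_cases hi : (i : ℕ) + 1 < n + 1
    · simp only [hψ, hi, dif_pos]
      exact hmono (Fin.le_def.2 (by simp))
    · simp only [hψ, hi, dif_neg, not_false_eq_true]
      exact (hmono (Fin.le_last i)).trans hlast
  have hnext : ∀ i : Fin (n + 1), cos (ψ (i + 1 : ℕ)) = cos (φ (i + 1))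
      ∧ sin (ψ (i + 1 : ℕ)) = sin (φ (i + 1)) := by
    intro i
    rcases Fin.eq_castSucc_or_eq_last i with ⟨j, rfl⟩ | rfl
    · have : ψ ((j.castSucc : ℕ) + 1) = φ (j.castSucc + 1) := by
        rw [← hψφ, Fin.coeSucc_eq_succ]; simp
      rw [this]; exact ⟨rfl, rfl⟩
    · simp [hψlast]
  have hint : ∫ θ in (0 : ℝ)..(2 * π), supportFun K θ
      = ∑ i : Fin (n + 1), ∫ θ in (ψ i)..(ψ (i + 1 : ℕ)), supportFun K (θ - π / 2) := by
    rw [Fin.sum_univ_eq_sum_range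
      (fun k => ∫ θ in (ψ k)..(ψ (k + 1)), supportFun K (θ - π / 2)),
      intervalIntegral.sum_integral_adjacent_intervals (fun k _ => hcont.intervalIntegrable _ _),
      hψlast, hψ0, intervalIntegral.integral_comp_sub_right (supportFun K) (π / 2),
      show φ 0 + 2 * π - π / 2 = φ 0 - π / 2 + 2 * π by ring,
      (supportFun_periodic K).intervalIntegral_add_eq (φ 0 - π / 2) 0, zero_add]
  have hpiece : ∀ i : Fin (n + 1),
      (x (i + 1)).re * (cos (φ i) - cos (φ (i + 1)))
        + (x (i + 1)).im * (sin (φ i) - sin (φ (i + 1)))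
        ≤ ∫ θ in (ψ i)..(ψ (i + 1 : ℕ)), supportFun K (θ - π / 2) := by
    intro i
    have hlin : ∫ θ in (ψ i)..(ψ (i + 1 : ℕ)),
        ((x (i + 1)).re * sin θ + (x (i + 1)).im * -cos θ) =
        (x (i + 1)).re * (cos (φ i) - cos (φ (i + 1)))
          + (x (i + 1)).im * (sin (φ i) - sin (φ (i + 1))) := by
      rw [intervalIntegral.integral_add (Continuous.intervalIntegrable (by fun_prop) _ _)
        (Continuous.intervalIntegrable (by fun_prop) _ _), intervalIntegral.integral_const_mul,
        intervalIntegral.integral_const_mul, intervalIntegral.integral_neg, integral_sin,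
        integral_cos, (hnext i).1, (hnext i).2, hψφ]
      ring
    rw [← hlin]
    refine intervalIntegral.integral_mono_on (hψstep i)
      (Continuous.intervalIntegrable (by fun_prop) _ _) (hcont.intervalIntegrable _ _)
      fun θ _ => ?_
    have := le_supportFun hK (hxK (i + 1)) (θ - π / 2)
    rwa [cos_sub_pi_div_two, sin_sub_pi_div_two] at this
  have hedge : ∀ i, ‖x (i + 1) - x i‖
      = ((x (i + 1)).re * cos (φ i) + (x (i + 1)).im * sin (φ i))
        - ((x i).re * cos (φ i) + (x i).im * sin (φ i)) := by
    intro i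
    have hre := congrArg Complex.re (hφ i)
    have him := congrArg Complex.im (hφ i)
    rw [Complex.re_ofReal_mul, Complex.exp_ofReal_mul_I_re, Complex.sub_re] at hre
    rw [Complex.im_ofReal_mul, Complex.exp_ofReal_mul_I_im, Complex.sub_im] at him
    linear_combination ‖x (i + 1) - x i‖ * (-1 : ℝ) * (sin_sq_add_cos_sq (φ i))
      - cos (φ i) * hre - sin (φ i) * him
  rw [hint]
  refine le_trans (le_of_eq ?_) (Finset.sum_le_sum fun i _ => hpiece i)
  unfold polygonPerimeter
  simp_rw [hedge, Finset.sum_sub_distrib]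
  rw [← sum_fin_succ_shift fun i => (x i).re * cos (φ i) + (x i).im * sin (φ i),
    ← Finset.sum_sub_distrib]
  exact Finset.sum_congr rfl fun i _ => by ring

theorem polygonPerimeter_le_perimeter {K : Set ℂ} (hK : IsCompact K) {n : ℕ}
    {x : Fin (n + 1) → ℂ} (hx : IsConvexPolygon x) (hxK : ∀ i, x i ∈ K) :
    polygonPerimeter x ≤ perimeter K := by
  refine le_csSup ⟨∫ θ in (0 : ℝ)..(2 * π), supportFun K θ, ?_⟩ ⟨n, x, hx, hxK, rfl⟩
  rintro _ ⟨n, x, hx, hxK, rfl⟩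
  exact polygonPerimeter_le_integral hK hx hxK

theorem isConvexPolygon_const (c : ℂ) : IsConvexPolygon (n := 0) fun _ => c :=
  ⟨fun _ => 0, monotone_const, by simp [pi_pos.le], by simp⟩

theorem perimeter_le_integral {K : Set ℂ} (hne : K.Nonempty) (hK : IsCompact K) :
    perimeter K ≤ ∫ θ in (0 : ℝ)..(2 * π), supportFun K θ := by
  obtain ⟨c, hc⟩ := hne
  refine csSup_le ⟨_, 0, fun _ => c, isConvexPolygon_const c, fun _ => hc, rfl⟩ ?_
  rintro _ ⟨n, x, hx, hxK, rfl⟩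
  exact polygonPerimeter_le_integral hK hx hxK

/-- A vector making a nonpositive product with the direction `0` and a nonnegative one with the
direction `ε` points into the sector between `π / 2` and `π / 2 + ε`. -/
theorem exists_direction_mem_Icc {ε θ : ℝ} (hε : 0 < ε) {v : ℂ}
    (h0 : v.re * cos θ + v.im * sin θ ≤ 0)
    (h1 : 0 ≤ v.re * cos (θ + ε) + v.im * sin (θ + ε)) :
    ∃ τ ∈ Set.Icc 0 ε, v = (‖v‖ : ℂ) * Complex.exp ((θ + π / 2 + τ : ℝ) * Complex.I) := by
  -- rotate so that the sector starts at the positive real axis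
  set w : ℂ := v * Complex.exp ((-(θ + π / 2) : ℝ) * Complex.I) with hw
  have hnorm : ‖w‖ = ‖v‖ := by rw [hw, norm_mul, Complex.norm_exp_ofReal_mul_I, mul_one]
  have hre : w.re = -(v.re * sin θ) + v.im * cos θ := by
    rw [hw, Complex.mul_re, Complex.exp_ofReal_mul_I_re, Complex.exp_ofReal_mul_I_im, cos_neg,
      sin_neg, cos_add_pi_div_two, sin_add_pi_div_two]
    ring
  have him : w.im = -(v.re * cos θ + v.im * sin θ) := by
    rw [hw, Complex.mul_im, Complex.exp_ofReal_mul_I_re, Complex.exp_ofReal_mul_I_im, cos_neg,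
      sin_neg, cos_add_pi_div_two, sin_add_pi_div_two]
    ring
  have harg0 : 0 ≤ w.arg := Complex.arg_nonneg_iff.2 (by linarith)
  have hpolar : (‖w‖ : ℂ) * Complex.exp (w.arg * Complex.I) = w := Complex.norm_mul_exp_arg_mul_I w
  refine ⟨w.arg, ⟨harg0, ?_⟩, ?_⟩
  · by_contra! hlt
    have hw0 : w ≠ 0 := by
      rintro h
      rw [h, Complex.arg_zero] at hlt
      linarith
    have hpos : 0 < sin (w.arg - ε) :=
      sin_pos_of_pos_of_lt_pi (by linarith) (by linarith [Complex.arg_le_pi w])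
    have hc := Complex.norm_mul_cos_arg w
    have hs := Complex.norm_mul_sin_arg w
    have hprod : ‖w‖ * sin (w.arg - ε) = -(v.re * cos (θ + ε) + v.im * sin (θ + ε)) := by
      rw [sin_sub, cos_add, sin_add]
      rw [hre] at hc
      rw [him] at hs
      linear_combination cos ε * hs - sin ε * hc
    have := mul_pos (norm_pos_iff.2 hw0) hpos
    linarith
  · rw [← hnorm]
    have : Complex.exp ((θ + π / 2 + w.arg : ℝ) * Complex.I)
        = Complex.exp (w.arg * Complex.I) * Complex.exp ((θ + π / 2 : ℝ) * Complex.I) := by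
      rw [← Complex.exp_add]; congr 1; push_cast; ring
    rw [this, ← mul_assoc, hpolar, hw, mul_assoc, ← Complex.exp_add]
    simp [← add_mul]

/-- The polygon through the support points in `N` equally spaced directions is convex, and its
perimeter is bounded below by a Riemann sum of the support function. -/
theorem riemannSum_le_perimeter {K : Set ℂ} (hne : K.Nonempty) (hK : IsCompact K) {N : ℕ}
    (hN : 3 ≤ N) {ε : ℝ} (hε : N * ε = 2 * π) :
    2 * sin (ε / 2) * ∑ j ∈ Finset.range N, supportFun K (j * ε) ≤ perimeter K := by
  obtain ⟨n, rfl⟩ : ∃ n, N = n + 1 := ⟨N - 1, by omega⟩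
  have hpi := pi_pos
  have hN' : (3 : ℝ) ≤ (n + 1 : ℕ) := by exact_mod_cast hN
  have hε0 : 0 < ε := by by_contra hneg; nlinarith
  have hεπ : ε < π := by nlinarith
  choose p hpK hp using exists_eq_supportFun hne hK
  set x : Fin (n + 1) → ℂ := fun i => p (i * ε) with hx
  have hsin : 0 < sin (ε / 2) := sin_pos_of_pos_of_lt_pi (by linarith) (by linarith)
  have hnext : ∀ i : Fin (n + 1), cos ((i + 1 : Fin (n + 1)) * ε) = cos (i * ε + ε)
      ∧ sin ((i + 1 : Fin (n + 1)) * ε) = sin (i * ε + ε) := by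
    intro i
    rcases Fin.eq_castSucc_or_eq_last i with ⟨j, rfl⟩ | rfl
    · rw [Fin.coeSucc_eq_succ]
      simp [add_mul]
    · have : (n : ℝ) * ε + ε = 2 * π := by rw [← hε]; push_cast; ring
      simp [this]
  have hmax : ∀ i k : Fin (n + 1), (x k).re * cos (i * ε) + (x k).im * sin (i * ε)
      ≤ (x i).re * cos (i * ε) + (x i).im * sin (i * ε) := by
    intro i k
    simp only [hx]
    rw [hp]
    exact le_supportFun hK (hpK _) _
  have hdir : ∀ i : Fin (n + 1), ∃ τ ∈ Set.Icc 0 ε, x (i + 1) - x i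
      = (‖x (i + 1) - x i‖ : ℂ) * Complex.exp ((i * ε + π / 2 + τ : ℝ) * Complex.I) := by
    intro i
    refine exists_direction_mem_Icc hε0 ?_ ?_
    · have := hmax i (i + 1)
      rw [Complex.sub_re, Complex.sub_im]
      linarith
    · have := hmax (i + 1) i
      rw [(hnext i).1, (hnext i).2] at this
      rw [Complex.sub_re, Complex.sub_im]
      linarith
  choose τ hτ hxτ using hdir
  have hpoly : IsConvexPolygon x := by
    refine ⟨fun i => i * ε + π / 2 + τ i, ?_, ?_, hxτ⟩
    · intro i j hij
      rcases hij.eq_or_lt with rfl | hlt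
      · exact le_rfl
      · have h1 : ((i : ℕ) : ℝ) + 1 ≤ (j : ℕ) := by exact_mod_cast hlt
        have h2 := (hτ i).2
        have h3 := (hτ j).1
        change (i : ℕ) * ε + π / 2 + τ i ≤ (j : ℕ) * ε + π / 2 + τ j
        nlinarith
    · have h2 := (hτ (Fin.last n)).2
      have h3 := (hτ 0).1
      push_cast at hε
      simp only [Fin.val_last, Fin.val_zero, Nat.cast_zero, zero_mul]
      linarith
  refine le_trans ?_ (polygonPerimeter_le_perimeter hK hpoly fun i => hpK _)
  -- project each edge on the bisector of the two adjacent normal directions, turned by `π / 2`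
  have hedge : ∀ i, ((x (i + 1)).re * cos (i * ε + ε) + (x (i + 1)).im * sin (i * ε + ε))
      + ((x i).re * cos (i * ε) + (x i).im * sin (i * ε))
      - ((x (i + 1)).re * cos (i * ε) + (x (i + 1)).im * sin (i * ε))
      - ((x i).re * cos (i * ε + ε) + (x i).im * sin (i * ε + ε))
      ≤ 2 * sin (ε / 2) * ‖x (i + 1) - x i‖ := by
    intro i
    obtain ⟨ψ, hψ⟩ : ∃ ψ : ℝ, i * ε = ψ - ε / 2 := ⟨i * ε + ε / 2, by ring⟩
    have hproj : -(x (i + 1) - x i).re * sin ψ + (x (i + 1) - x i).im * cos ψ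
        ≤ ‖x (i + 1) - x i‖ := by
      have h1 := Complex.re_le_norm
        ((x (i + 1) - x i) * Complex.exp ((-(ψ + π / 2) : ℝ) * Complex.I))
      rw [norm_mul, Complex.norm_exp_ofReal_mul_I, mul_one, Complex.mul_re,
        Complex.exp_ofReal_mul_I_re, Complex.exp_ofReal_mul_I_im, cos_neg, sin_neg,
        cos_add_pi_div_two, sin_add_pi_div_two] at h1
      linarith
    have h2 := mul_le_mul_of_nonneg_left hproj (by positivity : 0 ≤ 2 * sin (ε / 2))
    refine le_trans (le_of_eq ?_) h2
    rw [hψ, show ψ - ε / 2 + ε = ψ + ε / 2 by ring, cos_add, sin_add, cos_sub, sin_sub,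
      Complex.sub_re, Complex.sub_im]
    ring
  have hsum := Finset.sum_le_sum fun i (_ : i ∈ Finset.univ) => hedge i
  rw [← Finset.mul_sum] at hsum
  have hval : ∀ i : Fin (n + 1), (x i).re * cos (i * ε) + (x i).im * sin (i * ε)
      = supportFun K (i * ε) := fun i => hp _
  have heq : ∑ i : Fin (n + 1),
      (((x (i + 1)).re * cos (i * ε + ε) + (x (i + 1)).im * sin (i * ε + ε))
      + ((x i).re * cos (i * ε) + (x i).im * sin (i * ε))
      - ((x (i + 1)).re * cos (i * ε) + (x (i + 1)).im * sin (i * ε))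
      - ((x i).re * cos (i * ε + ε) + (x i).im * sin (i * ε + ε)))
      = (2 * sin (ε / 2)) ^ 2 * ∑ j ∈ Finset.range (n + 1), supportFun K (j * ε) := by
    have e1 : ∑ i : Fin (n + 1),
        ((x (i + 1)).re * cos (i * ε + ε) + (x (i + 1)).im * sin (i * ε + ε))
        = ∑ i : Fin (n + 1), supportFun K (i * ε) := by
      rw [← sum_fin_succ_shift fun i : Fin (n + 1) => supportFun K (i * ε)]
      refine Finset.sum_congr rfl fun i _ => ?_
      rw [← hval, (hnext i).1, (hnext i).2]
    have e2 : ∑ i : Fin (n + 1), ((x (i + 1)).re * cos (i * ε) + (x (i + 1)).im * sin (i * ε))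
        = ∑ i : Fin (n + 1), ((x i).re * cos (i * ε - ε) + (x i).im * sin (i * ε - ε)) := by
      rw [← sum_fin_succ_shift fun i : Fin (n + 1) =>
        (x i).re * cos (i * ε - ε) + (x i).im * sin (i * ε - ε)]
      refine Finset.sum_congr rfl fun i _ => ?_
      rw [cos_sub, sin_sub, (hnext i).1, (hnext i).2, ← cos_sub, ← sin_sub, add_sub_cancel_right]
    rw [Finset.sum_sub_distrib, Finset.sum_sub_distrib, Finset.sum_add_distrib, e1, e2,
      ← Fin.sum_univ_eq_sum_range (fun j : ℕ => supportFun K (j * ε)), ← Finset.sum_add_distrib,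
      ← Finset.sum_sub_distrib, ← Finset.sum_sub_distrib, Finset.mul_sum]
    refine Finset.sum_congr rfl fun i _ => ?_
    rw [← hval, cos_add, sin_add, cos_sub, sin_sub,
      cos_eq_one_sub_two_mul_sin_half_sq ε]
    ring
  rw [heq, sq, mul_assoc] at hsum
  exact le_of_mul_le_mul_left hsum (by positivity)

/-- Cauchy's formula. -/
theorem perimeter_eq_integral {K : Set ℂ} (hne : K.Nonempty) (hK : IsCompact K) :
    perimeter K = ∫ θ in (0 : ℝ)..(2 * π), supportFun K θ := by
  refine le_antisymm (perimeter_le_integral hne hK) ?_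
  have hlim := (tendsto_sinc_comp (u := fun N : ℕ => 2 * π / N / 2)
    (by simpa using tendsto_two_pi_div_nat.div_const 2)).mul
      (tendsto_riemannSum (continuous_supportFun hK))
  rw [one_mul] at hlim
  refine le_of_tendsto hlim ?_
  filter_upwards [eventually_ge_atTop 3] with N hN
  have hNpos : (0 : ℝ) < N := by
    have : 0 < N := by omega
    exact_mod_cast this
  have hpi := pi_pos
  set ε : ℝ := 2 * π / N with hεdef
  have hε0 : 0 < ε := by positivity
  refine le_trans (le_of_eq ?_) (riemannSum_le_perimeter hne hK hN (ε := ε)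
    (by rw [hεdef]; field_simp))
  rw [sinc_of_ne_zero (by positivity)]
  field_simp

/-! ### The Steiner point -/

theorem steinerPoint_eq {K : Set ℂ} (hK : IsCompact K) :
    steinerPoint K = ((1 / π * ∫ θ in (0 : ℝ)..(2 * π), supportFun K θ * cos θ : ℝ) : ℂ)
      + ((1 / π * ∫ θ in (0 : ℝ)..(2 * π), supportFun K θ * sin θ : ℝ) : ℂ) * Complex.I := by
  have hcont := continuous_supportFun hK
  have h1 : ∀ θ : ℝ, (supportFun K θ : ℂ) * Complex.exp (θ * Complex.I)
      = ((supportFun K θ * cos θ : ℝ) : ℂ) + ((supportFun K θ * sin θ : ℝ) : ℂ) * Complex.I := by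
    intro θ
    rw [Complex.exp_mul_I]
    push_cast
    ring
  unfold steinerPoint
  simp_rw [h1]
  rw [intervalIntegral.integral_add, intervalIntegral.integral_mul_const,
    intervalIntegral.integral_ofReal, intervalIntegral.integral_ofReal]
  · push_cast
    ring
  · exact Continuous.intervalIntegrable (by fun_prop) _ _
  · exact Continuous.intervalIntegrable (by fun_prop) _ _

theorem integral_supportFun_mul_cos_eq_zero {K : Set ℂ} (hK : IsCompact K)
    (hs : steinerPoint K = 0) (α : ℝ) :
    ∫ t in (0 : ℝ)..(2 * π), supportFun K (t + α) * cos t = 0 := by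
  have hcont := continuous_supportFun hK
  have hpi := pi_ne_zero
  rw [steinerPoint_eq hK] at hs
  have hA := congrArg Complex.re hs
  have hB := congrArg Complex.im hs
  simp only [Complex.add_re, Complex.add_im, Complex.ofReal_re, Complex.ofReal_im,
    Complex.re_ofReal_mul, Complex.im_ofReal_mul, Complex.I_re, Complex.I_im, Complex.zero_re,
    Complex.zero_im, mul_zero, mul_one, add_zero, zero_add, mul_eq_zero, one_div, inv_eq_zero,
    hpi, false_or] at hA hB
  have hper : Function.Periodic (fun u => supportFun K u * cos (u - α)) (2 * π) := fun u => by
    change supportFun K (u + 2 * π) * cos (u + 2 * π - α) = supportFun K u * cos (u - α)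
    rw [supportFun_periodic, ← cos_periodic (u - α)]
    ring_nf
  calc ∫ t in (0 : ℝ)..(2 * π), supportFun K (t + α) * cos t
      = ∫ t in (0 : ℝ)..(2 * π), supportFun K (t + α) * cos (t + α - α) := by simp
    _ = ∫ u in α..(α + 2 * π), supportFun K u * cos (u - α) := by
        rw [intervalIntegral.integral_comp_add_right (fun u => supportFun K u * cos (u - α)) α,
          zero_add, add_comm α]
    _ = ∫ u in (0 : ℝ)..(2 * π), supportFun K u * cos (u - α) := by
        rw [hper.intervalIntegral_add_eq α 0, zero_add]
    _ = ∫ u in (0 : ℝ)..(2 * π),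
          (supportFun K u * cos u * cos α + supportFun K u * sin u * sin α) := by
        congr 1
        ext u
        rw [cos_sub]
        ring
    _ = 0 := by
        rw [intervalIntegral.integral_add (Continuous.intervalIntegrable (by fun_prop) _ _)
          (Continuous.intervalIntegrable (by fun_prop) _ _), intervalIntegral.integral_mul_const,
          intervalIntegral.integral_mul_const, hA, hB]
        simp

/-- The two inequalities, in pointwise form. -/
theorem supportFun_perimeter_bounds {K : Set ℂ} (hne : K.Nonempty) (hK : IsCompact K)
    (hs : steinerPoint K = 0) (α : ℝ) :
    supportFun K α ≤ perimeter K / 4 ∧ perimeter K / 4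
      ≤ supportFun K α + (supportFun K (α + π / 2) + supportFun K (α - π / 2)) / 2 := by
  have hpi := pi_pos
  have hcont : Continuous fun t => supportFun K (t + α) :=
    (continuous_supportFun hK).comp (continuous_add_const α)
  have hper : Function.Periodic (fun t => supportFun K (t + α)) (2 * π) := fun t => by
    change supportFun K (t + 2 * π + α) = supportFun K (t + α)
    rw [← supportFun_periodic K (t + α)]
    ring_nf
  have hconv : ∀ θ ε, 2 * cos ε * supportFun K (θ + α)
      ≤ supportFun K (θ + ε + α) + supportFun K (θ - ε + α) := fun θ ε => by
    have := supportFun_second_diff_nonneg hne hK (θ + α) ε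
    rwa [add_right_comm, ← sub_add_eq_add_sub] at this
  have hP : ∫ t in (0 : ℝ)..(2 * π), supportFun K (t + α) = perimeter K := by
    rw [perimeter_eq_integral hne hK, intervalIntegral.integral_comp_add_right (supportFun K) α,
      add_comm (2 * π), zero_add, (supportFun_periodic K).intervalIntegral_add_eq α 0, zero_add]
  have h1 := le_integral_of_second_diff_nonneg hcont hper hconv
  have h2 := integral_le_of_second_diff_nonneg hcont hper hconv fun β => by
    simp_rw [add_assoc]
    exact integral_supportFun_mul_cos_eq_zero hK hs _
  rw [hP, integral_supportFun_mul_cos_eq_zero hK hs, zero_add] at h1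
  rw [hP, zero_add, add_comm _ α, neg_add_eq_sub] at h2
  exact ⟨le_of_mul_le_mul_left (by linarith) (show 0 < 2 * π by positivity), by linarith⟩

/-! ### Segments -/

theorem isCompact_segment (a b : ℂ) : IsCompact (segment ℝ a b) := by
  rw [segment_eq_image_lineMap]
  exact isCompact_Icc.image AffineMap.lineMap_continuous

theorem supportFun_segment (a b : ℂ) (θ : ℝ) :
    supportFun (segment ℝ a b) θ = ((a.re + b.re) / 2 * cos θ + (a.im + b.im) / 2 * sin θ)
      + |(b.re - a.re) / 2 * cos θ + (b.im - a.im) / 2 * sin θ| := by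
  have hK := isCompact_segment a b
  have ha := le_supportFun hK (left_mem_segment ℝ a b) θ
  have hb := le_supportFun hK (right_mem_segment ℝ a b) θ
  refine le_antisymm ?_ ?_
  · obtain ⟨x, ⟨s, t, hs, ht, hst, rfl⟩, hx⟩ :=
      exists_eq_supportFun ⟨a, left_mem_segment ℝ a b⟩ hK θ
    rw [← hx]
    simp only [Complex.add_re, Complex.add_im, Complex.real_smul, Complex.re_ofReal_mul,
      Complex.im_ofReal_mul]
    obtain rfl : s = 1 - t := by linarith
    have h1 := le_abs_self ((b.re - a.re) / 2 * cos θ + (b.im - a.im) / 2 * sin θ)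
    have h2 := neg_abs_le ((b.re - a.re) / 2 * cos θ + (b.im - a.im) / 2 * sin θ)
    nlinarith [mul_le_mul_of_nonneg_left h1 ht, mul_le_mul_of_nonneg_left h2 hs]
  · rcases abs_cases ((b.re - a.re) / 2 * cos θ + (b.im - a.im) / 2 * sin θ) with h | h <;>
      rw [h.1] <;> linarith

theorem integral_eq_zero_of_antiperiodic {q : ℝ → ℝ} (hq : Function.Antiperiodic q π) :
    ∫ θ in (0 : ℝ)..(2 * π), q θ = 0 := by
  have h1 : ∫ θ in (0 : ℝ)..(2 * π), q (θ + π) = ∫ θ in (0 : ℝ)..(2 * π), q θ := by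
    rw [intervalIntegral.integral_comp_add_right q π, zero_add, add_comm (2 * π),
      hq.periodic_two_mul.intervalIntegral_add_eq π 0, zero_add]
  have h2 : ∫ θ in (0 : ℝ)..(2 * π), q (θ + π) = -∫ θ in (0 : ℝ)..(2 * π), q θ := by
    rw [← intervalIntegral.integral_neg]
    exact intervalIntegral.integral_congr fun θ _ => hq θ
  linarith

/-- The Steiner point of a segment is its midpoint. -/
theorem steinerPoint_segment (a b : ℂ) : steinerPoint (segment ℝ a b) = (a + b) / 2 := by
  have hpi := pi_ne_zero
  have hanti : ∀ {u : ℝ → ℝ}, Function.Antiperiodic u π → Function.Antiperiodic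
      (fun θ => |(b.re - a.re) / 2 * cos θ + (b.im - a.im) / 2 * sin θ| * u θ) π := by
    intro u hu θ
    simp only [cos_add_pi, sin_add_pi, hu θ, mul_neg]
    rw [← neg_add, abs_neg]
  have hA : ∫ θ in (0 : ℝ)..(2 * π), supportFun (segment ℝ a b) θ * cos θ
      = π * ((a.re + b.re) / 2) := by
    have : ∀ θ, supportFun (segment ℝ a b) θ * cos θ = (a.re + b.re) / 2 * cos θ ^ 2
        + (a.im + b.im) / 2 * (sin θ * cos θ)
        + |(b.re - a.re) / 2 * cos θ + (b.im - a.im) / 2 * sin θ| * cos θ := fun θ => by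
      rw [supportFun_segment]; ring
    simp_rw [this]
    rw [intervalIntegral.integral_add (Continuous.intervalIntegrable (by fun_prop) _ _)
      (Continuous.intervalIntegrable (by fun_prop) _ _),
      intervalIntegral.integral_add (Continuous.intervalIntegrable (by fun_prop) _ _)
      (Continuous.intervalIntegrable (by fun_prop) _ _), intervalIntegral.integral_const_mul,
      intervalIntegral.integral_const_mul,
      integral_eq_zero_of_antiperiodic (hanti cos_antiperiodic), integral_cos_sq,
      integral_sin_mul_cos₁]
    simp
    ring
  have hB : ∫ θ in (0 : ℝ)..(2 * π), supportFun (segment ℝ a b) θ * sin θ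
      = π * ((a.im + b.im) / 2) := by
    have : ∀ θ, supportFun (segment ℝ a b) θ * sin θ = (a.re + b.re) / 2 * (sin θ * cos θ)
        + (a.im + b.im) / 2 * sin θ ^ 2
        + |(b.re - a.re) / 2 * cos θ + (b.im - a.im) / 2 * sin θ| * sin θ := fun θ => by
      rw [supportFun_segment]; ring
    simp_rw [this]
    rw [intervalIntegral.integral_add (Continuous.intervalIntegrable (by fun_prop) _ _)
      (Continuous.intervalIntegrable (by fun_prop) _ _),
      intervalIntegral.integral_add (Continuous.intervalIntegrable (by fun_prop) _ _)
      (Continuous.intervalIntegrable (by fun_prop) _ _), intervalIntegral.integral_const_mul,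
      intervalIntegral.integral_const_mul,
      integral_eq_zero_of_antiperiodic (hanti sin_antiperiodic), integral_sin_sq,
      integral_sin_mul_cos₁]
    simp
    ring
  rw [steinerPoint_eq (isCompact_segment a b), hA, hB]
  apply Complex.ext <;> simp [hpi]

theorem isLeast_isGreatest_supportFun_segment {a b : ℂ} (hab : a + b = 0) :
    IsLeast (Set.range (supportFun (segment ℝ a b))) 0 ∧
      IsGreatest (Set.range (supportFun (segment ℝ a b))) ‖b‖ := by
  obtain rfl : a = -b := by linear_combination hab
  have hsupp : ∀ θ, supportFun (segment ℝ (-b) b) θ = |b.re * cos θ + b.im * sin θ| := by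
    intro θ
    rw [supportFun_segment]
    simp
  have hc := Complex.norm_mul_cos_arg b
  have hs := Complex.norm_mul_sin_arg b
  refine ⟨⟨⟨b.arg + π / 2, ?_⟩, ?_⟩, ⟨⟨b.arg, ?_⟩, ?_⟩⟩
  · rw [hsupp, cos_add_pi_div_two, sin_add_pi_div_two, abs_eq_zero, ← hc, ← hs]
    ring
  · rintro _ ⟨θ, rfl⟩
    rw [hsupp]
    exact abs_nonneg _
  · rw [hsupp, ← hc, ← hs]
    rw [show ‖b‖ * cos b.arg * cos b.arg + ‖b‖ * sin b.arg * sin b.arg = ‖b‖ by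
      linear_combination ‖b‖ * sin_sq_add_cos_sq b.arg]
    exact abs_norm b
  · rintro _ ⟨θ, rfl⟩
    rw [hsupp, ← re_mul_conj_exp]
    refine (Complex.abs_re_le_norm _).trans (le_of_eq ?_)
    rw [norm_mul, Complex.norm_conj, Complex.norm_exp_ofReal_mul_I, mul_one]

/-! ### Extrema and the extremal segments -/

theorem exists_extrema_perimeter_bounds {K : Set ℂ} (hne : K.Nonempty) (hK : IsCompact K)
    (hs : steinerPoint K = 0) :
    ∃ m M : ℝ, IsLeast (Set.range (supportFun K)) m ∧ IsGreatest (Set.range (supportFun K)) M ∧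
      M ≤ perimeter K / 4 ∧ perimeter K / 4 ≤ m + M := by
  have hcomp : IsCompact (Set.range (supportFun K)) :=
    (supportFun_periodic K).compact_of_continuous (by positivity) (continuous_supportFun hK)
  obtain ⟨m, hm⟩ := hcomp.exists_isLeast (Set.range_nonempty _)
  obtain ⟨M, hM⟩ := hcomp.exists_isGreatest (Set.range_nonempty _)
  refine ⟨m, M, hm, hM, ?_, ?_⟩
  · obtain ⟨β, rfl⟩ := hM.1
    exact (supportFun_perimeter_bounds hne hK hs β).1
  · obtain ⟨α, rfl⟩ := hm.1
    have h := (supportFun_perimeter_bounds hne hK hs α).2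
    have h1 := hM.2 ⟨α + π / 2, rfl⟩
    have h2 := hM.2 ⟨α - π / 2, rfl⟩
    linarith

/-- The general bounds squeeze the perimeter between `4 max h` and `4 (0 + max h)`. -/
theorem perimeter_segment {a b : ℂ} (hab : a + b = 0) :
    perimeter (segment ℝ a b) / 4 = ‖b‖ := by
  obtain ⟨m, M, hm, hM, h1, h2⟩ := exists_extrema_perimeter_bounds
    ⟨a, left_mem_segment ℝ a b⟩ (isCompact_segment a b) (by rw [steinerPoint_segment, hab]; simp)
  obtain ⟨hm', hM'⟩ := isLeast_isGreatest_supportFun_segment hab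
  rw [hm.unique hm'] at h2
  rw [hM.unique hM'] at h1 h2
  linarith

theorem mainTheorem2 :
    (∀ K : Set ℂ, K.Nonempty → IsCompact K → Convex ℝ K → steinerPoint K = 0 →
      ∃ m M : ℝ, IsLeast (Set.range (supportFun K)) m ∧ IsGreatest (Set.range (supportFun K)) M ∧
        M ≤ perimeter K / 4 ∧ perimeter K / 4 ≤ m + M) ∧
    (∀ a b : ℂ, steinerPoint (segment ℝ a b) = 0 →
      ∃ m M : ℝ, IsLeast (Set.range (supportFun (segment ℝ a b))) m ∧
        IsGreatest (Set.range (supportFun (segment ℝ a b))) M ∧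
        M = perimeter (segment ℝ a b) / 4 ∧ perimeter (segment ℝ a b) / 4 = m + M) ∧
    (∀ L : ℝ, 0 < L → ∃ a b : ℂ,
      steinerPoint (segment ℝ a b) = 0 ∧ perimeter (segment ℝ a b) = L) := by
  refine ⟨fun K hne hK _ hs => exists_extrema_perimeter_bounds hne hK hs, fun a b hs => ?_,
    fun L hL => ?_⟩
  · have hab : a + b = 0 := by
      rw [steinerPoint_segment] at hs
      simpa using hs
    obtain ⟨hm, hM⟩ := isLeast_isGreatest_supportFun_segment hab
    exact ⟨0, ‖b‖, hm, hM, (perimeter_segment hab).symm, by rw [perimeter_segment hab, zero_add]⟩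
  · have hab : -((L / 4 : ℝ) : ℂ) + ((L / 4 : ℝ) : ℂ) = 0 := neg_add_cancel _
    refine ⟨_, _, by rw [steinerPoint_segment, hab, zero_div], ?_⟩
    have h := perimeter_segment hab
    rw [Complex.norm_of_nonneg (by positivity)] at h
    linarith
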